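/- Let $\mathcal A$ be a unital C$^*$-algebra and $\mathcal D=\{z\in\mathcal A:\|z\|<1\}$. Regard $\mathcal A^2$ (columns) as a right Hilbert C$^*$-module over $\mathcal A$ with norm $\|\mathbf x\|=\|x_1^*x_1+x_2^*x_2\|^{1/2}$, and put $\theta(\mathbf x,\mathbf y)=x_1^*y_1-x_2^*y_2$. For $z\in\mathcal D$ let $\ell_z=\{\binom1z a:a\in\mathcal A\}\subset\mathcal A^2$, and let $\mathbf e_z=\binom1z(1-z^*z)^{-1/2}$, a generator of $\ell_z$ with $\theta(\mathbf e_z,\mathbf e_z)=1$. The cross ratio $cr(0,z)$ is the module endomorphism of $\ell_z$ given by $$cr(0,z)\Big(\binom1z a\Big)=\binom1z(1+|z|)(1-|z|)^{-1}a,\qquad a\in\mathcal A,\quad |z|=(z^*z)^{1/2}.$$ Its logarithm $\log cr(0,z)$ is taken by identifying each module endomorphism $\varphi$ of $\ell_z$ with its matrix $m\in\mathcal A$ in the basis $\mathbf e_z$ (that is, $\varphi(\mathbf e_z)=\mathbf e_z m$) and taking the logarithm in $\mathcal A$. For $z\in\mathcal D$ and $X\in\mathcal A$, let $|X|_z=\|\theta(\mathbf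 v,\mathbf v)\|^{1/2}$, where $\mathbf v$ is the element of the $\theta$-orthogonal complement of $\ell_z$ that is congruent modulo $\ell_z$ to $\binom0X(1-z^*z)^{-1/2}$. This is the Finsler metric of $\mathcal D$; let $d(z_0,z_1)$ be the infimum of the lengths $\int_0^1|\dot\gamma(t)|_{\gamma(t)}\,dt$ of the $C^1$ curves $\gamma:[0,1]\to\mathcal D$ from $z_0$ to $z_1$. Then for every $z\in\mathcal D$ $$\tfrac12\,\|\log cr(0,z)\|_{\mathcal B(\ell_z)}=d(0,z)=\tfrac12\log\frac{1+\|z\|}{1-\|z\|},$$ where $\|\ \|_{\mathcal B(\ell_z)}$ is the norm of operators acting on $\ell_z\subset\mathcal A^2$. -/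

import Mathlib

open scoped RightActions WithCStarModule

noncomputable section

namespace PoincareDisk

/-- The C⋆-algebra `A` as a right Hilbert C⋆-module over itself, with `⟪x, y⟫ = x⋆ y`. A right
`A`-module is a module over the opposite algebra `Aᵐᵒᵖ`. -/
instance instRightCStarModule {A : Type*} [CStarAlgebra A] [PartialOrder A] [StarOrderedRing A] :
    CStarModule Aᵐᵒᵖ A where
  inner x y := MulOpposite.op (star x * y)
  inner_add_right := by simp [mul_add]
  inner_self_nonneg {x} := by
    have h : (0 : A) ≤ star x * x := star_mul_self_nonneg x
    exact h
  inner_self {x} := by simp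
  inner_op_smul_right {a x y} := by
    simp [MulOpposite.smul_eq_mul_unop, ← mul_assoc]
  inner_smul_right_complex := by simp
  star_inner x y := by simp [← MulOpposite.op_star]
  norm_eq_sqrt_norm_inner_self x := by
    rw [MulOpposite.norm_op, CStarRing.norm_star_mul_self, Real.sqrt_mul_self (norm_nonneg x)]

variable {A : Type*} [CStarAlgebra A]

/-- The standard right Hilbert C⋆-module `A² = A × A`, with `A`-valued inner product
`x₁⋆ y₁ + x₂⋆ y₂` and norm `‖x₁⋆ x₁ + x₂⋆ x₂‖ ^ (1/2)`. -/
abbrev A2 (A : Type*) [CStarAlgebra A] : Type _ := C⋆ᵐᵒᵈ(Aᵐᵒᵖ, A × A)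

/-- The column vector with entries `x₁`, `x₂`. -/
def col (x₁ x₂ : A) : A2 A := (WithCStarModule.equiv Aᵐᵒᵖ (A × A)).symm (x₁, x₂)

/-- The indefinite form `θ(x, y) = x₁⋆ y₁ - x₂⋆ y₂`. -/
def theta (x y : A2 A) : A := star x.1 * y.1 - star x.2 * y.2

/-- The submodule `ℓ_z = {(1, z) a : a ∈ A}` of `A²`. -/
def line (z : A) : Submodule Aᵐᵒᵖ (A2 A) := Submodule.span Aᵐᵒᵖ {col 1 z}

theorem col_smul_mem_line (z a : A) : col 1 z <• a ∈ line z :=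
  Submodule.smul_mem _ _ (Submodule.mem_span_singleton_self _)

/-- The module endomorphism `(1, z) a ↦ (1, z) (b a)` of `ℓ_z`. -/
def endo (z b : A) : line z →ₗ[Aᵐᵒᵖ] line z where
  toFun x := ⟨col 1 z <• (b * x.1.1), col_smul_mem_line z _⟩
  map_add' x y := by
    ext1
    change col 1 z <• (b * (x.1.1 + y.1.1)) = col 1 z <• (b * x.1.1) + col 1 z <• (b * y.1.1)
    rw [mul_add, MulOpposite.op_add, add_smul]
  map_smul' c x := by
    ext1
    change col 1 z <• (b * (x.1.1 * c.unop)) = c • (col 1 z <• (b * x.1.1))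
    rw [← mul_assoc, MulOpposite.op_mul, mul_smul, MulOpposite.op_unop]

theorem endo_apply (z b a : A) :
    endo z b ⟨col 1 z <• a, col_smul_mem_line z a⟩ =
      ⟨col 1 z <• (b * a), col_smul_mem_line z (b * a)⟩ := by
  ext1
  change col 1 z <• (b * (1 * a)) = col 1 z <• (b * a)
  rw [one_mul]

variable [PartialOrder A] [StarOrderedRing A]

/-- The operator norm of an endomorphism of `ℓ_z`, for the norm of `ℓ_z ⊆ A²`. -/
def opNorm {z : A} (φ : line z →ₗ[Aᵐᵒᵖ] line z) : ℝ :=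
  sInf {C : ℝ | 0 ≤ C ∧ ∀ x : line z, ‖(φ x : A2 A)‖ ≤ C * ‖(x : A2 A)‖}

/-- The cross ratio `cr(0, z)`: the endomorphism
`(1, z) a ↦ (1, z) (1 + |z|) (1 - |z|)⁻¹ a` of `ℓ_z`. -/
def crossRatio (z : A) : line z →ₗ[Aᵐᵒᵖ] line z :=
  endo z ((1 + CFC.abs z) * Ring.inverse (1 - CFC.abs z))

/-- `(1 - z⋆ z) ^ (1/2)`. -/
def defect (z : A) : A := CFC.sqrt (1 - star z * z)

/-- The generator `e_z = ((1 - z⋆ z) ^ (-1/2), z (1 - z⋆ z) ^ (-1/2))` of `ℓ_z`, which satisfies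
`θ(e_z, e_z) = 1`. -/
def gen (z : A) : A2 A := col 1 z <• Ring.inverse (defect z)

/-- The matrix of `φ` in the basis `e_z` of `ℓ_z`: the element `m` with `φ(e_z) = e_z m`. -/
def endMatrix {z : A} (φ : line z →ₗ[Aᵐᵒᵖ] line z) : A :=
  defect z * (φ ⟨gen z, col_smul_mem_line z _⟩ : A2 A).1

/-- The endomorphism of `ℓ_z` whose matrix in the basis `e_z` is `m`, i.e. `e_z a ↦ e_z (m a)`. -/
def ofMatrix (z m : A) : line z →ₗ[Aᵐᵒᵖ] line z :=
  endo z (Ring.inverse (defect z) * m * defect z)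

/-- The logarithm of an endomorphism of `ℓ_z`, where endomorphisms are identified with their
matrices in the basis `e_z`, and the logarithm in `A` is the one of the continuous functional
calculus. -/
def endLog {z : A} (φ : line z →ₗ[Aᵐᵒᵖ] line z) : line z →ₗ[Aᵐᵒᵖ] line z :=
  ofMatrix z (CFC.log (endMatrix φ))

/-- The representative in `A²` of the tangent vector `X` of the disk at `z`: the derivative at
`t = 0` of the curve `(1, z + t X) (1 - z⋆ z) ^ (-1/2)` of generators of `ℓ_{z + t X}`, which
starts at `e_z`. It is determined modulo `ℓ_z`. -/
def lift (z X : A) : A2 A := col 0 X <• Ring.inverse (defect z)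

/-- The representative of the tangent vector `X` in the `θ`-orthogonal complement of `ℓ_z`: the
lift of `X` minus its `θ`-orthogonal projection `e_z θ(e_z, lift)` to `ℓ_z`. -/
def tangentRep (z X : A) : A2 A := lift z X - gen z <• theta (gen z) (lift z X)

/-- The Finsler norm `|X|_z = ‖θ(v, v)‖ ^ (1/2)` of a tangent vector `X` at `z`, where `v` is its
representative in the `θ`-orthogonal complement of `ℓ_z`. -/
def finslerNorm (z X : A) : ℝ := √‖theta (tangentRep z X) (tangentRep z X)‖

/-- The length of the curve `γ : [0, 1] → A` for the Finsler metric of the disk. -/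
def length (γ : ℝ → A) : ℝ :=
  ∫ t in (0 : ℝ)..1, finslerNorm (γ t) (derivWithin γ (Set.Icc 0 1) t)

/-- The Finsler distance of the unit disk of `A`: the infimum of the lengths of the `C¹` curves
`[0, 1] → {a : ‖a‖ < 1}` from `z₀` to `z₁`. -/
def finslerDist (z₀ z₁ : A) : ℝ :=
  sInf {L : ℝ | ∃ γ : ℝ → A, ContDiffOn ℝ 1 γ (Set.Icc 0 1) ∧
    (∀ t ∈ Set.Icc (0 : ℝ) 1, ‖γ t‖ < 1) ∧ γ 0 = z₀ ∧ γ 1 = z₁ ∧ L = length γ}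

end PoincareDisk

end

open scoped RightActions WithCStarModule

noncomputable section

namespace PoincareDisk

/-! ### Inverses of 1 - z⋆z and 1 - zz⋆ -/

section Algebra

variable {A : Type*} [CStarAlgebra A] {z : A}

/-! Both outer quantities are compared with artanh ‖z‖ = ½ log((1 + ‖z‖)/(1 - ‖z‖)).

Metric side: |X|_z = ‖(1 - zz⋆)^(-1/2) X (1 - z⋆z)^(-1/2)‖ (`finslerNorm_eq`). Hence |X|_z ≤ ‖X‖/(1
- ‖z‖²), and the segment t ↦ tz has length at most artanh ‖z‖. For the lower bound, follow P = (1 -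
γ⋆γ)⁻¹ along a curve γ from 0: writing ‖γ‖ = tanh r, one has ‖P‖ = cosh² r
(`norm_inverse_one_sub_star_mul_self`) and ‖P'‖ ≤ 2 sinh r cosh r |γ'|_γ (`norm_deriv_inverse_le`).
So r grows no faster than arc length, by a differential inequality (`artanh_norm_le_length`).

Cross ratio side: functions of |z| commute with z⋆z, so their matrix in e_z is the function itself
and their operator norm on ℓ_z is the norm in A. The functional calculus then gives ‖log((1 + |z|)(1
- |z|)⁻¹)‖ = 2 artanh ‖z‖. -/

theorem norm_star_mul_self_lt_one (hz : ‖z‖ < 1) : ‖star z * z‖ < 1 := by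
  rw [CStarRing.norm_star_mul_self]
  nlinarith [norm_nonneg z]

theorem norm_mul_star_self_lt_one (hz : ‖z‖ < 1) : ‖z * star z‖ < 1 := by
  simpa using norm_star_mul_self_lt_one (z := star z) (by simpa using hz)

theorem isUnit_one_sub_star_mul_self (hz : ‖z‖ < 1) : IsUnit (1 - star z * z) :=
  (Units.oneSub _ (norm_star_mul_self_lt_one hz)).isUnit

theorem isUnit_one_sub_mul_star_self (hz : ‖z‖ < 1) : IsUnit (1 - z * star z) :=
  (Units.oneSub _ (norm_mul_star_self_lt_one hz)).isUnit

theorem inverse_mul_star_eq (hz : ‖z‖ < 1) :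
    Ring.inverse (1 - star z * z) * star z = star z * Ring.inverse (1 - z * star z) := by
  have h1 := isUnit_one_sub_star_mul_self hz
  have h2 := isUnit_one_sub_mul_star_self hz
  rw [← h1.mul_right_inj, ← mul_assoc, Ring.mul_inverse_cancel _ h1, one_mul]
  have : (1 - star z * z) * (star z * Ring.inverse (1 - z * star z))
      = star z * ((1 - z * star z) * Ring.inverse (1 - z * star z)) := by noncomm_ring
  rw [this, Ring.mul_inverse_cancel _ h2, mul_one]

theorem inverse_one_sub_mul_star_self (hz : ‖z‖ < 1) :
    Ring.inverse (1 - z * star z) = 1 + z * Ring.inverse (1 - star z * z) * star z := by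
  have h2 := isUnit_one_sub_mul_star_self hz
  rw [mul_assoc, inverse_mul_star_eq hz]
  have : Ring.inverse (1 - z * star z) =
      (1 - z * star z) * Ring.inverse (1 - z * star z)
        + z * (star z * Ring.inverse (1 - z * star z)) := by noncomm_ring
  rw [Ring.mul_inverse_cancel _ h2] at this
  exact this

theorem norm_inverse_one_sub_le [Nontrivial A] {t : A} (ht : ‖t‖ < 1) :
    ‖Ring.inverse (1 - t)‖ ≤ 1 / (1 - ‖t‖) := by
  have h := tsum_geometric_le_of_norm_lt_one t ht
  rw [CStarRing.norm_one, sub_self, zero_add] at h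
  rw [NormedRing.inverse_one_sub t ht, one_div]
  exact h

theorem norm_inverse_one_sub_star_mul_self_le [Nontrivial A] (hz : ‖z‖ < 1) :
    ‖Ring.inverse (1 - star z * z)‖ ≤ 1 / (1 - ‖z‖ ^ 2) := by
  have := norm_inverse_one_sub_le (norm_star_mul_self_lt_one hz)
  rwa [CStarRing.norm_star_mul_self, ← sq] at this

theorem norm_inverse_one_sub_mul_star_self_le [Nontrivial A] (hz : ‖z‖ < 1) :
    ‖Ring.inverse (1 - z * star z)‖ ≤ 1 / (1 - ‖z‖ ^ 2) := by
  simpa using norm_inverse_one_sub_star_mul_self_le (z := star z) (by simpa using hz)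

end Algebra

/-! ### The Finsler norm in closed form and its estimates -/

section Order

variable {A : Type*} [CStarAlgebra A] [PartialOrder A] [StarOrderedRing A] {z : A}

theorem one_sub_nonneg_of_norm_lt_one {t : A} (ht₀ : 0 ≤ t) (ht : ‖t‖ < 1) : 0 ≤ 1 - t :=
  sub_nonneg.2 ((CStarAlgebra.norm_le_one_iff_of_nonneg t ht₀).1 ht.le)

theorem one_sub_star_mul_self_nonneg (hz : ‖z‖ < 1) : 0 ≤ 1 - star z * z :=
  one_sub_nonneg_of_norm_lt_one (star_mul_self_nonneg z) (norm_star_mul_self_lt_one hz)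

theorem one_sub_mul_star_self_nonneg (hz : ‖z‖ < 1) : 0 ≤ 1 - z * star z :=
  one_sub_nonneg_of_norm_lt_one (mul_star_self_nonneg z) (norm_mul_star_self_lt_one hz)

theorem inverse_nonneg {a : A} (h0 : 0 ≤ a) (ha : IsUnit a) : 0 ≤ Ring.inverse a := by
  have h : Ring.inverse a = star (Ring.inverse a) * a * Ring.inverse a := by
    rw [← Ring.inverse_star, (IsSelfAdjoint.of_nonneg h0).star_eq, Ring.inverse_mul_cancel _ ha,
      one_mul]
  rw [h]
  exact star_left_conjugate_nonneg h0 _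

theorem isUnit_sqrt {a : A} (h0 : 0 ≤ a) (ha : IsUnit a) : IsUnit (CFC.sqrt a) := by
  rw [← CFC.sqrt_mul_sqrt_self a h0] at ha
  exact (Commute.refl _).isUnit_mul_iff.1 ha |>.1

theorem defect_mul_defect (hz : ‖z‖ < 1) : defect z * defect z = 1 - star z * z :=
  CFC.sqrt_mul_sqrt_self _ (one_sub_star_mul_self_nonneg hz)

theorem isUnit_defect (hz : ‖z‖ < 1) : IsUnit (defect z) :=
  isUnit_sqrt (one_sub_star_mul_self_nonneg hz) (isUnit_one_sub_star_mul_self hz)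

theorem star_defect (z : A) : star (defect z) = defect z :=
  (IsSelfAdjoint.of_nonneg (CFC.sqrt_nonneg _)).star_eq

theorem star_inverse_defect (z : A) : star (Ring.inverse (defect z)) = Ring.inverse (defect z) := by
  rw [← Ring.inverse_star, star_defect]

theorem inverse_defect_mul_inverse_defect (hz : ‖z‖ < 1) :
    Ring.inverse (defect z) * Ring.inverse (defect z) = Ring.inverse (1 - star z * z) := by
  rw [← defect_mul_defect hz, Ring.mul_inverse_rev' (Commute.refl _)]

theorem norm_inverse_defect_sq (hz : ‖z‖ < 1) :
    ‖Ring.inverse (defect z)‖ ^ 2 = ‖Ring.inverse (1 - star z * z)‖ := by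
  rw [← inverse_defect_mul_inverse_defect hz, sq, ← CStarRing.norm_star_mul_self,
    star_inverse_defect]

/-- `(1 - z z⋆) ^ (-1/2)`. -/
def coInvDefect (z : A) : A := CFC.sqrt (Ring.inverse (1 - z * star z))

theorem star_coInvDefect (z : A) : star (coInvDefect z) = coInvDefect z :=
  (IsSelfAdjoint.of_nonneg (CFC.sqrt_nonneg _)).star_eq

theorem coInvDefect_mul_self (hz : ‖z‖ < 1) :
    coInvDefect z * coInvDefect z = Ring.inverse (1 - z * star z) :=
  CFC.sqrt_mul_sqrt_self _
    (inverse_nonneg (one_sub_mul_star_self_nonneg hz) (isUnit_one_sub_mul_star_self hz))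

theorem norm_coInvDefect_sq (hz : ‖z‖ < 1) :
    ‖coInvDefect z‖ ^ 2 = ‖Ring.inverse (1 - z * star z)‖ := by
  rw [← coInvDefect_mul_self hz, sq, ← CStarRing.norm_star_mul_self, star_coInvDefect]

/-- Since θ(e_z, e_z) = 1, removing the component c = θ(e_z, lift) subtracts c⋆c from θ(lift, lift).
The two terms combine through 1 + z(1 - z⋆z)⁻¹z⋆ = (1 - zz⋆)⁻¹. -/
theorem theta_tangentRep (hz : ‖z‖ < 1) (X : A) :
    theta (tangentRep z X) (tangentRep z X) =
      -(star (coInvDefect z * X * Ring.inverse (defect z)) *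
        (coInvDefect z * X * Ring.inverse (defect z))) := by
  have hQ : star (coInvDefect z * X * Ring.inverse (defect z)) *
        (coInvDefect z * X * Ring.inverse (defect z)) =
      Ring.inverse (defect z) * star X *
        (1 + z * (Ring.inverse (defect z) * Ring.inverse (defect z)) * star z) *
          X * Ring.inverse (defect z) := by
    rw [inverse_defect_mul_inverse_defect hz, ← inverse_one_sub_mul_star_self hz,
      ← coInvDefect_mul_self hz]
    simp only [star_mul, star_coInvDefect, star_inverse_defect, mul_assoc]
  rw [hQ]
  set e := Ring.inverse (defect z) with he
  have he' : star e = e := star_inverse_defect z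
  have hkey : e * (1 - star z * z) * e = 1 := by
    rw [← defect_mul_defect hz, he, ← mul_assoc, Ring.inverse_mul_cancel _ (isUnit_defect hz),
      one_mul, Ring.mul_inverse_cancel _ (isUnit_defect hz)]
  set c : A := -(e * star z * X * e) with hc
  have hth : theta (gen z) (lift z X) = c := by
    change star ((1 : A) * e) * ((0 : A) * e) - star (z * e) * (X * e) = c
    rw [hc, star_mul z e, he']
    simp [mul_assoc]
  have h1 : (tangentRep z X).1 = -(e * c) := by
    rw [tangentRep, hth]
    change (0 : A) * e - (1 : A) * e * c = _
    simp
  have h2 : (tangentRep z X).2 = X * e - z * e * c := by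
    rw [tangentRep, hth]
    rfl
  have hsc : star c = -(e * star X * z * e) := by
    rw [hc]; simp [he', mul_assoc]
  have e1 : theta (tangentRep z X) (tangentRep z X) =
      star c * (e * (1 - star z * z) * e) * c - e * star X * X * e
        + e * star X * z * e * c + star c * (e * star z * X * e) := by
    rw [theta, h1, h2]
    simp only [star_neg, star_mul, star_sub, he']
    noncomm_ring
  rw [e1, hkey, hsc, hc]
  noncomm_ring

theorem finslerNorm_eq (hz : ‖z‖ < 1) (X : A) :
    finslerNorm z X = ‖coInvDefect z * X * Ring.inverse (defect z)‖ := by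
  rw [finslerNorm, theta_tangentRep hz, norm_neg, CStarRing.norm_star_mul_self,
    Real.sqrt_mul_self (norm_nonneg _)]

theorem finslerNorm_le [Nontrivial A] (hz : ‖z‖ < 1) (X : A) :
    finslerNorm z X ≤ ‖X‖ / (1 - ‖z‖ ^ 2) := by
  rw [finslerNorm_eq hz]
  have hpos : 0 < 1 - ‖z‖ ^ 2 := by nlinarith [norm_nonneg z]
  have h1 := (norm_coInvDefect_sq hz).trans_le (norm_inverse_one_sub_mul_star_self_le hz)
  have h2 := (norm_inverse_defect_sq hz).trans_le (norm_inverse_one_sub_star_mul_self_le hz)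
  have h3 : ‖coInvDefect z‖ * ‖Ring.inverse (defect z)‖ ≤ 1 / (1 - ‖z‖ ^ 2) := by
    -- A product is at most the mean of the squares, and both squares are at most 1/(1 - ‖z‖²).
    nlinarith [sq_nonneg (‖coInvDefect z‖ - ‖Ring.inverse (defect z)‖)]
  calc ‖coInvDefect z * X * Ring.inverse (defect z)‖
      ≤ ‖coInvDefect z‖ * ‖X‖ * ‖Ring.inverse (defect z)‖ := norm_mul₃_le
    _ = ‖X‖ * (‖coInvDefect z‖ * ‖Ring.inverse (defect z)‖) := by ring
    _ ≤ ‖X‖ * (1 / (1 - ‖z‖ ^ 2)) := by gcongr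
    _ = _ := by ring

/-- The differential of `z ↦ (1 - z⋆ z)⁻¹` is controlled by the Finsler norm. -/
theorem norm_inverse_mul_mul_inverse_le [Nontrivial A] (hz : ‖z‖ < 1) (X : A) :
    ‖Ring.inverse (1 - star z * z) * (star z * X) * Ring.inverse (1 - star z * z)‖ ≤
      ‖z‖ / (1 - ‖z‖ ^ 2) * finslerNorm z X := by
  rw [finslerNorm_eq hz]
  set s := coInvDefect z with hs
  set e := Ring.inverse (defect z) with he
  have hpos : 0 < 1 - ‖z‖ ^ 2 := by nlinarith [norm_nonneg z]
  have h1 := (norm_coInvDefect_sq hz).trans_le (norm_inverse_one_sub_mul_star_self_le hz)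
  have h2 := (norm_inverse_defect_sq hz).trans_le (norm_inverse_one_sub_star_mul_self_le hz)
  have h3 : ‖s‖ * ‖e‖ ≤ 1 / (1 - ‖z‖ ^ 2) := by
    nlinarith [sq_nonneg (‖s‖ - ‖e‖)]
  -- Moving z⋆ to the left turns (1 - z⋆z)⁻¹ into (1 - zz⋆)⁻¹ = s², which isolates the factor sXe
  -- whose norm is the Finsler norm.
  have h4 : Ring.inverse (1 - star z * z) * (star z * X) * Ring.inverse (1 - star z * z) =
      star z * s * (s * X * e) * e := by
    rw [← mul_assoc, inverse_mul_star_eq hz, ← coInvDefect_mul_self hz,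
      ← inverse_defect_mul_inverse_defect hz]
    simp only [← hs, ← he, mul_assoc]
  rw [h4]
  calc ‖star z * s * (s * X * e) * e‖ ≤ ‖star z * s‖ * ‖s * X * e‖ * ‖e‖ := norm_mul₃_le
    _ ≤ ‖z‖ * ‖s‖ * ‖s * X * e‖ * ‖e‖ := by
      gcongr
      simpa using norm_mul_le (star z) s
    _ = ‖z‖ * (‖s‖ * ‖e‖) * ‖s * X * e‖ := by ring
    _ ≤ ‖z‖ * (1 / (1 - ‖z‖ ^ 2)) * ‖s * X * e‖ := by gcongr
    _ = _ := by ring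

/-- For the lower bound, conjugating P ≤ ‖P‖ by (1 - z⋆z)^(1/2) gives 1 ≤ ‖P‖(1 - z⋆z), that is z⋆z
≤ 1 - 1/‖P‖; then take norms. -/
theorem norm_inverse_one_sub_star_mul_self [Nontrivial A] (hz : ‖z‖ < 1) :
    ‖Ring.inverse (1 - star z * z)‖ = 1 / (1 - ‖z‖ ^ 2) := by
  refine le_antisymm (norm_inverse_one_sub_star_mul_self_le hz) ?_
  set P := Ring.inverse (1 - star z * z) with hP
  have hP0 : 0 ≤ P :=
    inverse_nonneg (one_sub_star_mul_self_nonneg hz) (isUnit_one_sub_star_mul_self hz)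
  have hd : defect z * P * defect z = 1 := by
    rw [hP, ← inverse_defect_mul_inverse_defect hz, ← mul_assoc,
      Ring.mul_inverse_cancel _ (isUnit_defect hz), one_mul,
      Ring.inverse_mul_cancel _ (isUnit_defect hz)]
  have hPpos : 0 < ‖P‖ := by
    refine norm_pos_iff.2 fun h => ?_
    rw [h] at hd
    simp at hd
  have hle : (1 : A) ≤ ‖P‖ • (1 - star z * z) := by
    have := star_left_conjugate_le_conjugate
      (IsSelfAdjoint.le_algebraMap_norm_self (IsSelfAdjoint.of_nonneg hP0)) (defect z)
    rw [star_defect, hd, Algebra.algebraMap_eq_smul_one, mul_smul_comm, smul_mul_assoc, mul_one,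
      defect_mul_defect hz] at this
    exact this
  have hle2 : star z * z ≤ algebraMap ℝ A (1 - 1 / ‖P‖) := by
    have h := smul_le_smul_of_nonneg_left hle (inv_nonneg.2 hPpos.le)
    rw [smul_smul, inv_mul_cancel₀ hPpos.ne', one_smul] at h
    rw [Algebra.algebraMap_eq_smul_one, sub_smul, one_smul, one_div]
    exact le_sub_comm.1 h
  have hP1 : 0 ≤ 1 - 1 / ‖P‖ := by
    have h := (star_mul_self_nonneg z).trans hle2
    rwa [← map_zero (algebraMap ℝ A), algebraMap_le_algebraMap] at h
  have h := (CStarAlgebra.norm_le_iff_le_algebraMap _ hP1 (star_mul_self_nonneg z)).2 hle2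
  rw [CStarRing.norm_star_mul_self, ← sq] at h
  rw [div_le_iff₀ (by nlinarith [norm_nonneg z])]
  have h5 : 1 / ‖P‖ ≤ 1 - ‖z‖ ^ 2 := by linarith
  rwa [div_le_iff₀' hPpos] at h5

end Order

/-! ### Norms and matrices of endomorphisms of ℓ_z -/

section OperatorNorm

theorem coe_eq_col_smul {A : Type*} [CStarAlgebra A] {z : A} (x : line z) : (x : A2 A) = col 1 z <• (x : A2 A).1 := by
  obtain ⟨c, hc⟩ := Submodule.mem_span_singleton.1 x.2
  have h : (x : A2 A).1 = c.unop := by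
    rw [← hc]
    exact one_mul _
  rw [h, MulOpposite.op_unop, hc]

variable {A : Type*} [CStarAlgebra A] [PartialOrder A] [StarOrderedRing A] {z : A}

theorem one_add_star_mul_self_nonneg (z : A) : 0 ≤ 1 + star z * z :=
  add_nonneg zero_le_one (star_mul_self_nonneg z)

theorem isUnit_one_add_star_mul_self (z : A) : IsUnit (1 + star z * z) :=
  (IsStrictlyPositive.add_nonneg (by exact isStrictlyPositive_one)
    (star_mul_self_nonneg z)).isUnit

theorem norm_col_smul (z a : A) : ‖col 1 z <• a‖ = ‖CFC.sqrt (1 + star z * z) * a‖ := by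
  rw [WithCStarModule.prod_norm]
  change √‖MulOpposite.op (star ((1 : A) * a) * (1 * a)) +
    MulOpposite.op (star (z * a) * (z * a))‖ = _
  have hs : star (CFC.sqrt (1 + star z * z)) = CFC.sqrt (1 + star z * z) :=
    (IsSelfAdjoint.of_nonneg (CFC.sqrt_nonneg _)).star_eq
  have h : star ((1 : A) * a) * (1 * a) + star (z * a) * (z * a) =
      star (CFC.sqrt (1 + star z * z) * a) * (CFC.sqrt (1 + star z * z) * a) := by
    rw [star_mul (CFC.sqrt (1 + star z * z)) a, hs, mul_assoc, ← mul_assoc (CFC.sqrt _) _ a,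
      CFC.sqrt_mul_sqrt_self _ (one_add_star_mul_self_nonneg z), star_mul z a]
    noncomm_ring
  rw [← MulOpposite.op_add, MulOpposite.norm_op, h, CStarRing.norm_star_mul_self,
    Real.sqrt_mul_self (norm_nonneg _)]

/-- The map (1, z)a ↦ ha, with h = (1 + z⋆z)^(1/2), is an isometry of ℓ_z onto A. As c commutes with
h, the endomorphism becomes left multiplication by c. -/
theorem opNorm_endo {c : A} (hc : Commute c (star z * z)) : opNorm (endo z c) = ‖c‖ := by
  set h := CFC.sqrt (1 + star z * z) with hh
  have hch : Commute c h := by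
    have h1 : Commute (1 + star z * z) c := ((Commute.one_right c).add_right hc).symm
    exact (h1.cfcₙ_nnreal _).symm
  have hu : IsUnit h :=
    isUnit_sqrt (one_add_star_mul_self_nonneg z) (isUnit_one_add_star_mul_self z)
  have hendo (x : line z) : ‖(endo z c x : A2 A)‖ = ‖c * (h * (x : A2 A).1)‖ := by
    change ‖col 1 z <• (c * (x : A2 A).1)‖ = _
    rw [norm_col_smul, ← mul_assoc, ← hh, ← hch.eq, mul_assoc]
  have hx (x : line z) : ‖(x : A2 A)‖ = ‖h * (x : A2 A).1‖ := by
    rw [← norm_col_smul, ← coe_eq_col_smul]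
  have hmem : ‖c‖ ∈ {C : ℝ | 0 ≤ C ∧ ∀ x : line z, ‖(endo z c x : A2 A)‖ ≤ C * ‖(x : A2 A)‖} := by
    refine ⟨norm_nonneg c, fun x => ?_⟩
    rw [hendo, hx]
    exact norm_mul_le _ _
  refine le_antisymm (csInf_le ⟨0, fun C hC => hC.1⟩ hmem) (le_csInf ⟨_, hmem⟩ ?_)
  rintro C ⟨hC0, hC⟩
  cases subsingleton_or_nontrivial A
  · rw [Subsingleton.elim c 0, norm_zero]
    exact hC0
  -- This unit vector corresponds to 1 ∈ A, where left multiplication by c attains its norm.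
  · have h1 := hC ⟨col 1 z <• Ring.inverse h, col_smul_mem_line z _⟩
    rw [hendo, hx] at h1
    change ‖c * (h * (1 * Ring.inverse h))‖ ≤ C * ‖h * (1 * Ring.inverse h)‖ at h1
    rwa [one_mul, Ring.mul_inverse_cancel _ hu, mul_one, CStarRing.norm_one, mul_one] at h1

theorem endMatrix_endo (hz : ‖z‖ < 1) {b : A} (hb : Commute b (star z * z)) :
    endMatrix (endo z b) = b := by
  have hbd : Commute b (defect z) := by
    have h1 : Commute (1 - star z * z) b := ((Commute.one_right b).sub_right hb).symm
    exact (h1.cfcₙ_nnreal _).symm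
  change defect z * (1 * (b * (1 * Ring.inverse (defect z)))) = b
  rw [one_mul, one_mul, ← mul_assoc, ← hbd.eq, mul_assoc,
    Ring.mul_inverse_cancel _ (isUnit_defect hz), mul_one]

theorem ofMatrix_eq_endo (hz : ‖z‖ < 1) {m : A} (hm : Commute m (star z * z)) :
    ofMatrix z m = endo z m := by
  have hmd : Commute m (defect z) := by
    have h1 : Commute (1 - star z * z) m := ((Commute.one_right m).sub_right hm).symm
    exact (h1.cfcₙ_nnreal _).symm
  rw [ofMatrix, mul_assoc, hmd.eq, ← mul_assoc, Ring.inverse_mul_cancel _ (isUnit_defect hz),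
    one_mul]

end OperatorNorm

/-! ### The logarithm of the cross ratio -/

section Logarithm

variable {A : Type*} [CStarAlgebra A] [PartialOrder A] [StarOrderedRing A]

theorem mem_Icc_of_mem_spectrum {a : A} (ha : 0 ≤ a) {t : ℝ} (ht : t ∈ spectrum ℝ a) :
    t ∈ Set.Icc 0 ‖a‖ := by
  cases subsingleton_or_nontrivial A
  · simp [spectrum.of_subsingleton] at ht
  · exact ⟨spectrum_nonneg_of_nonneg ha ht, (le_abs_self t).trans (spectrum.norm_le_norm_of_mem ht)⟩

theorem continuousOn_cayley {a : A} (ha : 0 ≤ a) (ha1 : ‖a‖ < 1) :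
    ContinuousOn (fun t : ℝ => (1 + t) / (1 - t)) (spectrum ℝ a) := by
  refine ContinuousOn.div (by fun_prop) (by fun_prop) fun t ht => ?_
  have := (mem_Icc_of_mem_spectrum ha ht).2
  linarith

theorem one_add_mul_inverse_one_sub_eq_cfc {a : A} (ha : 0 ≤ a) (ha1 : ‖a‖ < 1) :
    (1 + a) * Ring.inverse (1 - a) = cfc (fun t : ℝ => (1 + t) / (1 - t)) a := by
  have hsa : IsSelfAdjoint a := .of_nonneg ha
  have hu : IsUnit (1 - a) := (Units.oneSub a ha1).isUnit
  have h1 : (1 : A) - a = cfc (fun t : ℝ => 1 - t) a := by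
    rw [cfc_sub (fun _ => (1 : ℝ)) (fun t => t) a, cfc_const_one ℝ a, cfc_id' ℝ a]
  have h2 : (1 : A) + a = cfc (fun t : ℝ => 1 + t) a := by
    rw [cfc_add a (fun _ => (1 : ℝ)) (fun t => t), cfc_const_one ℝ a, cfc_id' ℝ a]
  have h3 : cfc (fun t : ℝ => (1 + t) / (1 - t)) a * (1 - a) = 1 + a := by
    rw [h1, h2, ← cfc_mul _ _ a (continuousOn_cayley ha ha1) (by fun_prop)]
    refine cfc_congr fun t ht => ?_
    have := (mem_Icc_of_mem_spectrum ha ht).2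
    exact div_mul_cancel₀ _ (by linarith)
  rw [← h3, mul_assoc, Ring.mul_inverse_cancel _ hu, mul_one]

theorem log_one_add_mul_inverse_one_sub {a : A} (ha : 0 ≤ a) (ha1 : ‖a‖ < 1) :
    CFC.log ((1 + a) * Ring.inverse (1 - a)) =
      cfc (fun t : ℝ => Real.log ((1 + t) / (1 - t))) a := by
  have hsa : IsSelfAdjoint a := .of_nonneg ha
  rw [one_add_mul_inverse_one_sub_eq_cfc ha ha1, CFC.log,
    ← cfc_comp' Real.log _ a ?_ (continuousOn_cayley ha ha1)]
  refine Real.continuousOn_log.mono ?_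
  rintro _ ⟨t, ht, rfl⟩
  obtain ⟨h0, h1⟩ := mem_Icc_of_mem_spectrum ha ht
  have : 0 < (1 + t) / (1 - t) := div_pos (by linarith) (by linarith)
  simpa using this.ne'

/-- The function log((1 + t)/(1 - t)) is nonnegative and increasing on [0, 1), and ‖a‖ is the
largest point of the spectrum of a. -/
theorem norm_log_one_add_mul_inverse_one_sub {a : A} (ha : 0 ≤ a) (ha1 : ‖a‖ < 1) :
    ‖CFC.log ((1 + a) * Ring.inverse (1 - a))‖ = Real.log ((1 + ‖a‖) / (1 - ‖a‖)) := by
  cases subsingleton_or_nontrivial A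
  · rw [Subsingleton.elim (CFC.log ((1 + a) * Ring.inverse (1 - a))) 0, Subsingleton.elim a 0]
    simp
  have hlog {t : ℝ} (h0 : 0 ≤ t) (h1 : t < 1) : 0 ≤ Real.log ((1 + t) / (1 - t)) :=
    Real.log_nonneg ((one_le_div (by linarith)).2 (by linarith))
  have hcont : ContinuousOn (fun t : ℝ => Real.log ((1 + t) / (1 - t))) (spectrum ℝ a) := by
    refine (continuousOn_cayley ha ha1).log fun t ht => ?_
    obtain ⟨h0, h1⟩ := mem_Icc_of_mem_spectrum ha ht
    exact (div_pos (by linarith) (by linarith)).ne'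
  rw [log_one_add_mul_inverse_one_sub ha ha1]
  refine le_antisymm (norm_cfc_le (hlog (norm_nonneg a) ha1) fun t ht => ?_) ?_
  · obtain ⟨h0, h1⟩ := mem_Icc_of_mem_spectrum ha ht
    rw [Real.norm_of_nonneg (hlog h0 (h1.trans_lt ha1))]
    refine Real.log_le_log (div_pos (by linarith) (by linarith)) ?_
    exact div_le_div₀ (by linarith) (by linarith) (by linarith) (by linarith)
  · have := norm_apply_le_norm_cfc (fun t : ℝ => Real.log ((1 + t) / (1 - t))) a
      (CStarAlgebra.norm_mem_spectrum_of_nonneg ha) hcont (.of_nonneg ha)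
    rwa [Real.norm_of_nonneg (hlog (norm_nonneg a) ha1)] at this

theorem opNorm_endLog_crossRatio {z : A} (hz : ‖z‖ < 1) :
    opNorm (endLog (crossRatio z)) = Real.log ((1 + ‖z‖) / (1 - ‖z‖)) := by
  have ha : 0 ≤ CFC.abs z := CFC.abs_nonneg z
  have hna : ‖CFC.abs z‖ = ‖z‖ := CFC.norm_abs
  have ha1 : ‖CFC.abs z‖ < 1 := hna.trans_lt hz
  have hsa : IsSelfAdjoint (CFC.abs z) := .of_nonneg ha
  have hcomm (f : ℝ → ℝ) : Commute (cfc f (CFC.abs z)) (star z * z) := by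
    have h : Commute (cfc f (CFC.abs z)) (CFC.abs z) := by
      simpa only [cfc_id' ℝ (CFC.abs z)] using cfc_commute_cfc f (fun t => t) (CFC.abs z)
    rw [← CFC.abs_mul_abs]
    exact h.mul_right h
  have hb := hcomm (fun t : ℝ => (1 + t) / (1 - t))
  rw [← one_add_mul_inverse_one_sub_eq_cfc ha ha1] at hb
  have hl := hcomm (fun t : ℝ => Real.log ((1 + t) / (1 - t)))
  rw [← log_one_add_mul_inverse_one_sub ha ha1] at hl
  rw [endLog, crossRatio, endMatrix_endo hz hb, ofMatrix_eq_endo hz hl, opNorm_endo hl,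
    norm_log_one_add_mul_inverse_one_sub ha ha1, hna]

end Logarithm

/-! ### The Finsler distance from 0 -/

section Distance

theorem hasDerivWithinAt_inverse_one_sub_star_mul_self {A : Type*} [CStarAlgebra A]
    {γ : ℝ → A} {X : A} {s : Set ℝ} {t : ℝ}
    (hγ : HasDerivWithinAt γ X s t) (hD : ‖γ t‖ < 1) :
    HasDerivWithinAt (fun t => Ring.inverse (1 - star (γ t) * γ t))
      (Ring.inverse (1 - star (γ t) * γ t) * (star X * γ t + star (γ t) * X) *
        Ring.inverse (1 - star (γ t) * γ t)) s t := by
  obtain ⟨u, hu⟩ := isUnit_one_sub_star_mul_self hD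
  have hi := hasFDerivAt_ringInverse (𝕜 := ℝ) u
  have h := HasFDerivAt.comp_hasDerivWithinAt_of_eq t hi
    ((hγ.star.mul hγ).const_sub 1) hu
  refine HasDerivWithinAt.congr_deriv h ?_
  rw [← hu, Ring.inverse_unit]
  change -(↑u⁻¹ * -(star X * γ t + star (γ t) * X) * ↑u⁻¹) = _
  rw [mul_neg, neg_mul, neg_neg]

theorem norm_smul_lt_one_of_mem_Icc {A : Type*} [CStarAlgebra A] {z : A} (hz : ‖z‖ < 1) {t : ℝ} (ht : t ∈ Set.Icc (0 : ℝ) 1) :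
    ‖t • z‖ < 1 := by
  rw [norm_smul, Real.norm_of_nonneg ht.1]
  nlinarith [ht.2, norm_nonneg z]

theorem continuousOn_inverse {A : Type*} [CStarAlgebra A] {f : ℝ → A} {s : Set ℝ} (hf : ContinuousOn f s)
    (hu : ∀ t ∈ s, IsUnit (f t)) : ContinuousOn (fun t => Ring.inverse (f t)) s := by
  intro t ht
  obtain ⟨u, hu⟩ := hu t ht
  have h := NormedRing.inverse_continuousAt u
  rw [hu] at h
  exact h.comp_continuousWithinAt (hf t ht)

variable {A : Type*} [CStarAlgebra A] [PartialOrder A] [StarOrderedRing A] {z : A}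

theorem finslerNorm_nonneg (z X : A) : 0 ≤ finslerNorm z X := Real.sqrt_nonneg _

theorem length_nonneg (γ : ℝ → A) : 0 ≤ length γ :=
  intervalIntegral.integral_nonneg zero_le_one fun _ _ => finslerNorm_nonneg _ _

theorem hasDerivAt_artanh_mul {r t : ℝ} (h0 : 0 ≤ t * r) (h1 : t * r < 1) :
    HasDerivAt (fun t => (1 / 2 : ℝ) * (Real.log (1 + t * r) - Real.log (1 - t * r)))
      (r / (1 - (t * r) ^ 2)) t := by
  have hm : HasDerivAt (fun t : ℝ => t * r) r t := by
    simpa using (hasDerivAt_id t).mul_const r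
  have h := (((hm.const_add 1).log (by linarith)).sub
    ((hm.const_sub 1).log (by linarith))).const_mul (1 / 2 : ℝ)
  refine HasDerivAt.congr_deriv h (Eq.symm ?_)
  have h2 : 1 + t * r ≠ 0 := by linarith
  have h3 : 1 - t * r ≠ 0 := by linarith
  have h4 : 1 - (t * r) ^ 2 ≠ 0 := by
    rw [show 1 - (t * r) ^ 2 = (1 + t * r) * (1 - t * r) by ring]
    exact mul_ne_zero h2 h3
  rw [div_sub_div _ _ h2 h3, show (1 + t * r) * (1 - t * r) = 1 - (t * r) ^ 2 by ring]
  field_simp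
  ring

theorem continuousOn_div_one_sub_sq {r : ℝ} (h0 : 0 ≤ r) (h1 : r < 1) :
    ContinuousOn (fun t : ℝ => r / (1 - (t * r) ^ 2)) (Set.uIcc 0 1) := by
  refine ContinuousOn.div (by fun_prop) (by fun_prop) fun t ht => ?_
  rw [Set.uIcc_of_le zero_le_one] at ht
  have h2 : 0 ≤ t * r := mul_nonneg ht.1 h0
  have h3 : t * r < 1 := by nlinarith [ht.2]
  nlinarith

theorem integral_div_one_sub_sq {r : ℝ} (h0 : 0 ≤ r) (h1 : r < 1) :
    ∫ t in (0 : ℝ)..1, r / (1 - (t * r) ^ 2) = (1 / 2 : ℝ) * Real.log ((1 + r) / (1 - r)) := by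
  rw [intervalIntegral.integral_eq_sub_of_hasDerivAt
    (f := fun t => (1 / 2 : ℝ) * (Real.log (1 + t * r) - Real.log (1 - t * r))) ?_
    (continuousOn_div_one_sub_sq h0 h1).intervalIntegrable]
  · rw [Real.log_div (by linarith) (by linarith)]
    simp
  · intro t ht
    rw [Set.uIcc_of_le zero_le_one] at ht
    exact hasDerivAt_artanh_mul (mul_nonneg ht.1 h0) (by nlinarith [ht.2])

theorem length_segment_le [Nontrivial A] (hz : ‖z‖ < 1) :
    length (fun t : ℝ => t • z) ≤ (1 / 2 : ℝ) * Real.log ((1 + ‖z‖) / (1 - ‖z‖)) := by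
  rw [← integral_div_one_sub_sq (norm_nonneg z) hz, length,
    intervalIntegral.integral_of_le zero_le_one, intervalIntegral.integral_of_le zero_le_one]
  -- This comparison needs integrability of the larger integrand only.
  refine MeasureTheory.integral_mono_of_nonneg (.of_forall fun _ => finslerNorm_nonneg _ _)
    (((intervalIntegrable_iff_integrableOn_Ioc_of_le zero_le_one).1
      (continuousOn_div_one_sub_sq (norm_nonneg z) hz).intervalIntegrable)) ?_
  refine (MeasureTheory.ae_restrict_iff' measurableSet_Ioc).2 (.of_forall fun t ht => ?_)
  have ht' : t ∈ Set.Icc (0 : ℝ) 1 := ⟨ht.1.le, ht.2⟩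
  have hd : derivWithin (fun t : ℝ => t • z) (Set.Icc 0 1) t = z := by
    have h : HasDerivAt (fun t : ℝ => t • z) z t := by
      simpa using (hasDerivAt_id t).smul_const z
    exact h.hasDerivWithinAt.derivWithin (uniqueDiffOn_Icc zero_lt_one t ht')
  dsimp only
  rw [hd]
  refine (finslerNorm_le (norm_smul_lt_one_of_mem_Icc hz ht') z).trans_eq ?_
  rw [norm_smul, Real.norm_of_nonneg ht'.1]

theorem continuousOn_cfcSqrt {f : ℝ → A} {s : Set ℝ} (hf : ContinuousOn f s)
    (h0 : ∀ t ∈ s, 0 ≤ f t) : ContinuousOn (fun t => CFC.sqrt (f t)) s :=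
  CFC.continuousOn_sqrt.comp hf h0

theorem continuousOn_finslerNorm {γ X : ℝ → A} {s : Set ℝ} (hγ : ContinuousOn γ s)
    (hX : ContinuousOn X s) (hD : ∀ t ∈ s, ‖γ t‖ < 1) :
    ContinuousOn (fun t => finslerNorm (γ t) (X t)) s := by
  have h1 : ContinuousOn (fun t => Ring.inverse (defect (γ t))) s :=
    continuousOn_inverse
      (continuousOn_cfcSqrt (continuousOn_const.sub (hγ.star.mul hγ))
        fun t ht => one_sub_star_mul_self_nonneg (hD t ht))
      fun t ht => isUnit_defect (hD t ht)
  have h2 : ContinuousOn (fun t => coInvDefect (γ t)) s :=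
    continuousOn_cfcSqrt
      (continuousOn_inverse (continuousOn_const.sub (hγ.mul hγ.star))
        fun t ht => isUnit_one_sub_mul_star_self (hD t ht))
      fun t ht => inverse_nonneg (one_sub_mul_star_self_nonneg (hD t ht))
        (isUnit_one_sub_mul_star_self (hD t ht))
  exact ((h2.mul hX).mul h1).norm.congr fun t ht => finslerNorm_eq (hD t ht) _

theorem norm_deriv_inverse_le [Nontrivial A] (hz : ‖z‖ < 1) (X : A) :
    ‖Ring.inverse (1 - star z * z) * (star X * z + star z * X) * Ring.inverse (1 - star z * z)‖ ≤
      2 * (‖z‖ / (1 - ‖z‖ ^ 2)) * finslerNorm z X := by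
  set P := Ring.inverse (1 - star z * z) with hP
  have hPs : star P = P := by
    rw [hP, ← Ring.inverse_star]
    simp
  have h : P * (star X * z + star z * X) * P =
      star (P * (star z * X) * P) + P * (star z * X) * P := by
    simp only [star_mul, hPs, star_star]
    noncomm_ring
  have hb := norm_inverse_mul_mul_inverse_le hz X
  rw [h]
  refine (norm_add_le _ _).trans ?_
  rw [norm_star]
  linarith

/-- ‖P‖ need not be differentiable, so the norm of the differentiable curve P is compared with the
barrier cosh² u, where u slightly exceeds the arc length U. -/
theorem artanh_norm_le_length [Nontrivial A] {γ : ℝ → A} (hγ : ContDiffOn ℝ 1 γ (Set.Icc 0 1))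
    (hD : ∀ t ∈ Set.Icc (0 : ℝ) 1, ‖γ t‖ < 1) (h0 : γ 0 = 0) :
    Real.artanh ‖γ 1‖ ≤ length γ := by
  set X := derivWithin γ (Set.Icc 0 1) with hX
  have hXc : ContinuousOn X (Set.Icc 0 1) :=
    hγ.continuousOn_derivWithin (uniqueDiffOn_Icc zero_lt_one) le_rfl
  have hFc := continuousOn_finslerNorm hγ.continuousOn hXc hD
  -- Extending the speed continuously to ℝ makes its primitive U differentiable everywhere,
  -- endpoints included.
  set F : ℝ → ℝ := Set.IccExtend (zero_le_one' ℝ)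
    ((Set.Icc (0 : ℝ) 1).domRestrict fun t => finslerNorm (γ t) (X t)) with hF
  have hFcont : Continuous F := (continuousOn_iff_continuous_domRestrict.1 hFc).Icc_extend'
  have hFeq {t : ℝ} (ht : t ∈ Set.Icc (0 : ℝ) 1) : F t = finslerNorm (γ t) (X t) :=
    Set.IccExtend_of_mem _ _ ht
  have hF0 (t : ℝ) : 0 ≤ F t := finslerNorm_nonneg _ _
  set U : ℝ → ℝ := fun t => ∫ s in (0 : ℝ)..t, F s with hU
  have hUd (t : ℝ) : HasDerivAt U (F t) t :=
    intervalIntegral.integral_hasDerivAt_right (hFcont.intervalIntegrable _ _)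
      (hFcont.stronglyMeasurableAtFilter _ _) hFcont.continuousAt
  have hUL : U 1 = length γ :=
    intervalIntegral.integral_congr fun t ht => hFeq (Set.uIcc_of_le (zero_le_one' ℝ) ▸ ht)
  have hU0 {t : ℝ} (ht : 0 ≤ t) : 0 ≤ U t :=
    intervalIntegral.integral_nonneg ht fun s _ => hF0 s
  have hone : (1 : ℝ) ∈ Set.Icc (0 : ℝ) 1 := Set.right_mem_Icc.2 zero_le_one
  rw [← hUL]
  refine le_of_forall_pos_le_add fun ε hε => ?_
  -- The slope ε/2 makes the derivative inequality strict, the shift by 1 keeps u > 0 at t = 0, and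
  -- the total excess at t = 1 is ε.
  set u : ℝ → ℝ := fun t => U t + ε / 2 * (t + 1) with hu
  have hud (t : ℝ) : HasDerivAt u (F t + ε / 2) t := by
    exact HasDerivAt.congr_deriv
      ((hUd t).add (((hasDerivAt_id t).add_const 1).const_mul (ε / 2))) (by rw [mul_one])
  have hupos {t : ℝ} (ht : 0 ≤ t) : 0 < u t := add_pos_of_nonneg_of_pos (hU0 ht) (by positivity)
  have hBd (t : ℝ) : HasDerivAt (fun t => Real.cosh (u t) ^ 2)
      (2 * Real.cosh (u t) * (Real.sinh (u t) * (F t + ε / 2))) t := by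
    exact HasDerivAt.congr_deriv ((hud t).cosh.pow 2) (by simp)
  have key := image_norm_le_of_norm_deriv_right_lt_deriv_boundary'
    (f := fun t => Ring.inverse (1 - star (γ t) * γ t))
    (f' := fun t => Ring.inverse (1 - star (γ t) * γ t) *
      (star (X t) * γ t + star (γ t) * X t) * Ring.inverse (1 - star (γ t) * γ t))
    (a := 0) (b := 1) ?_ ?_ (B := fun t => Real.cosh (u t) ^ 2) ?_
    (fun t _ => (hBd t).continuousAt.continuousWithinAt)
    (fun t _ => (hBd t).hasDerivWithinAt) ?_ hone
  · have hr := hD 1 hone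
    have hmem : ‖γ 1‖ ∈ Set.Ioo (-1 : ℝ) 1 := ⟨by linarith [norm_nonneg (γ 1)], hr⟩
    rw [norm_inverse_one_sub_star_mul_self hr] at key
    have hcosh : 1 / (1 - ‖γ 1‖ ^ 2) = Real.cosh (Real.artanh ‖γ 1‖) ^ 2 := by
      have hc := Real.cosh_pos (Real.artanh ‖γ 1‖)
      have h1 := Real.cosh_sq (Real.artanh ‖γ 1‖)
      conv_lhs => rw [← Real.tanh_artanh hmem, Real.tanh_eq_sinh_div_cosh, div_pow]
      rw [one_sub_div (by positivity), one_div_div, h1, add_sub_cancel_left, div_one]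
    rw [hcosh, sq_le_sq₀ (Real.cosh_pos _).le (Real.cosh_pos _).le, Real.cosh_le_cosh,
      abs_of_pos (hupos zero_le_one)] at key
    refine (le_abs_self _).trans (key.trans_eq ?_)
    simp only [hu]
    ring
  · exact continuousOn_inverse (continuousOn_const.sub (hγ.continuousOn.star.mul hγ.continuousOn))
      fun t ht => isUnit_one_sub_star_mul_self (hD t ht)
  · intro t ht
    have ht' := Set.Ico_subset_Icc_self ht
    refine hasDerivWithinAt_inverse_one_sub_star_mul_self ?_ (hD t ht')
    refine ((hγ.differentiableOn one_ne_zero t ht').hasDerivWithinAt).mono_of_mem_nhdsWithin ?_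
    exact Icc_mem_nhdsGE_of_mem ht
  · rw [h0, mul_zero, sub_zero, Ring.inverse_one, CStarRing.norm_one]
    exact one_le_pow₀ (Real.one_le_cosh (u 0))
  · intro t ht heq
    have ht' := Set.Ico_subset_Icc_self ht
    have hr := hD t ht'
    have hu0 := hupos ht.1
    rw [norm_inverse_one_sub_star_mul_self hr] at heq
    refine (norm_deriv_inverse_le hr (X t)).trans_lt ?_
    rw [← hFeq ht']
    have hpos : 0 < 1 - ‖γ t‖ ^ 2 := by nlinarith [norm_nonneg (γ t)]
    have hs := Real.sinh_pos_iff.2 hu0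
    have hc := Real.cosh_pos (u t)
    -- Strictness is needed only where ‖P‖ meets the barrier; there `heq` says ‖γ t‖ = tanh (u t).
    have h2 : ‖γ t‖ / (1 - ‖γ t‖ ^ 2) = Real.sinh (u t) * Real.cosh (u t) := by
      have h3 : Real.sinh (u t) ^ 2 = ‖γ t‖ ^ 2 * Real.cosh (u t) ^ 2 := by
        rw [Real.sinh_sq, ← heq]
        field_simp
        ring
      rw [← mul_pow, sq_eq_sq₀ hs.le (by positivity)] at h3
      rw [h3, div_eq_mul_one_div, heq]
      ring
    rw [h2]
    nlinarith [mul_pos (mul_pos hs hc) hε]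

theorem finslerDist_zero_left (hz : ‖z‖ < 1) :
    finslerDist 0 z = (1 / 2 : ℝ) * Real.log ((1 + ‖z‖) / (1 - ‖z‖)) := by
  have hseg : length (fun t : ℝ => t • z) ∈
      {L : ℝ | ∃ γ : ℝ → A, ContDiffOn ℝ 1 γ (Set.Icc 0 1) ∧
        (∀ t ∈ Set.Icc (0 : ℝ) 1, ‖γ t‖ < 1) ∧ γ 0 = 0 ∧ γ 1 = z ∧ L = length γ} :=
    ⟨fun t => t • z, by fun_prop, fun t ht => norm_smul_lt_one_of_mem_Icc hz ht, by simp, by simp, rfl⟩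
  have hbdd : BddBelow {L : ℝ | ∃ γ : ℝ → A, ContDiffOn ℝ 1 γ (Set.Icc 0 1) ∧
      (∀ t ∈ Set.Icc (0 : ℝ) 1, ‖γ t‖ < 1) ∧ γ 0 = 0 ∧ γ 1 = z ∧ L = length γ} :=
    ⟨0, by rintro _ ⟨γ, -, -, -, -, rfl⟩; exact length_nonneg γ⟩
  cases subsingleton_or_nontrivial A
  -- In the zero algebra ‖1‖ = 0, so the estimates above are unavailable, but every length vanishes.
  · have hfin (w X : A) : finslerNorm w X = 0 := by
      rw [finslerNorm, Subsingleton.elim (theta _ _) 0, norm_zero, Real.sqrt_zero]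
    have hlen : length (fun t : ℝ => t • z) = 0 := by simp [length, hfin]
    rw [Subsingleton.elim z 0] at *
    simp only [norm_zero, add_zero, sub_zero, div_one, Real.log_one, mul_zero]
    refine le_antisymm (hlen ▸ csInf_le hbdd hseg) (le_csInf ⟨_, hseg⟩ ?_)
    rintro _ ⟨γ, -, -, -, -, rfl⟩
    exact length_nonneg γ
  · refine le_antisymm ((csInf_le hbdd hseg).trans (length_segment_le hz))
      (le_csInf ⟨_, hseg⟩ ?_)
    rintro _ ⟨γ, hγ, hD, h0, rfl, rfl⟩
    rw [← Real.artanh_eq_half_log ⟨by linarith [norm_nonneg (γ 1)], hz.le⟩]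
    exact artanh_norm_le_length hγ hD h0

end Distance

end PoincareDisk

end

theorem theorem9 {A : Type*} [CStarAlgebra A] [PartialOrder A] [StarOrderedRing A]
    (z : A) (hz : ‖z‖ < 1) :
    (1 / 2 : ℝ) * PoincareDisk.opNorm (PoincareDisk.endLog (PoincareDisk.crossRatio z)) =
        PoincareDisk.finslerDist 0 z ∧
      PoincareDisk.finslerDist 0 z = (1 / 2 : ℝ) * Real.log ((1 + ‖z‖) / (1 - ‖z‖)) := by
  rw [PoincareDisk.opNorm_endLog_crossRatio hz, PoincareDisk.finslerDist_zero_left hz]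
  exact ⟨rfl, rfl⟩
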